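/- Let $X$ be a real normed linear space with a Schauder basis $(e_n)_{n\in\mathbb N}$ (the coordinate functionals being continuous, which is automatic if $X$ is complete), and let $B_X=\{x\in X:\|x\|\le 1\}$. For $x=\sum_n\lambda_ne_n$ put $\operatorname{supp}x=\{n:\lambda_n\ne0\}$; for nonzero $x,y$ write $x<y$ if $\max\operatorname{supp}x<\min\operatorname{supp}y$ (in particular $\operatorname{supp}x$ is finite). A block sequence is an infinite sequence $(x_n)_{n\in\mathbb N}$ of nonzero vectors of $X$ with $x_n<x_{n+1}$ for all $n$; a block sequence $(y_n)_n$ is a block subsequence of a block sequence $Z=(z_n)_n$ if every $y_n$ lies in the linear span $\langle Z\rangle$ of $\{z_i:i\in\mathbb N\}$. Let $\mathcal B^\infty_{B_X}$ be the set of block sequences with all terms in $B_X$, with the topology induced by the product of the norm topologies on $X^{\mathbb N}$, and let $\mathcal B^\infty_{B_X}(Z)$ be the set of those that are block subsequences of $Z$. For a sequence $\Delta=(\delta_n)_n$ of positive reals and $\mathcal F\subseteq\mathcal B^\infty_{B_X}$, let $\mathcal F_\Delta$ be the set of all block sequences $(u_n)_n$ in $X$ for which there is $(v_n)_n\in\mathcal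 F$ with $\|u_n-v_n\|\le\delta_n$ for all $n$. In Gowers' game $G_X(Z)$, at move $n=0,1,2,\dots$ player I chooses $W_n\in\mathcal B^\infty_{B_X}(Z)$ and then player II chooses a nonzero vector $w_n\in\langle W_n\rangle\cap B_X$, with $w_{n-1}<w_n$ if $n\ge1$. Player II wins the game for a family $\mathcal G$ of block sequences if $(w_n)_n\in\mathcal G$. **Theorem (W. T. Gowers).** Let $\mathcal F\subseteq\mathcal B^\infty_{B_X}$ be analytic (that is, empty or a continuous image of $\mathbb N^{\mathbb N}$). Then for every sequence $\Delta=(\delta_n)_n$ of positive real numbers there is a block sequence $Z$ in $X$ such that either $\mathcal B^\infty_{B_X}(Z)\cap\mathcal F=\emptyset$, or player II has a winning strategy in $G_X(Z)$ for $\mathcal F_\Delta$. -/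

import Mathlib

section Blocks

variable {X : Type*} [NormedAddCommGroup X] [NormedSpace ℝ X]

/-- The support of a vector with respect to a Schauder basis. -/
def basisSupport (e : SchauderBasis ℝ X) (x : X) : Set ℕ :=
  {i | e.coord i x ≠ 0}

/-- `x < y`: both vectors are nonzero and `max (supp x) < min (supp y)`.
Since `supp y` is nonempty, this forces `supp x` to be finite. -/
def BlockLT (e : SchauderBasis ℝ X) (x y : X) : Prop :=
  x ≠ 0 ∧ y ≠ 0 ∧ ∀ i ∈ basisSupport e x, ∀ j ∈ basisSupport e y, i < j

/-- Infinite block sequences with respect to the basis `e`. -/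
def IsBlockSeq (e : SchauderBasis ℝ X) (U : ℕ → X) : Prop :=
  ∀ n, BlockLT e (U n) (U (n + 1))

/-- The set of all block sequences whose terms belong to `D`. -/
def blockSeqs (e : SchauderBasis ℝ X) (D : Set X) : Set (ℕ → X) :=
  {U | IsBlockSeq e U ∧ ∀ n, U n ∈ D}

/-- The set of all block sequences with terms in `D` that are block subsequences of `Z`. -/
def blockSubseqs (e : SchauderBasis ℝ X) (D : Set X) (Z : ℕ → X) : Set (ℕ → X) :=
  {U | U ∈ blockSeqs e D ∧ ∀ n, U n ∈ Submodule.span ℝ (Set.range Z)}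

/-- The `Δ`-expansion of a family of block sequences. -/
def blockExpansion (e : SchauderBasis ℝ X) (F : Set (ℕ → X)) (Δ : ℕ → ℝ) : Set (ℕ → X) :=
  {U | IsBlockSeq e U ∧ ∃ V ∈ F, ∀ n, ‖U n - V n‖ ≤ Δ n}

/-- A strategy for player II: at move `n` it yields a vector from the moves
`W 0, …, W n` that player I has made so far. -/
abbrev PlayerIIStrategy (X : Type*) : Type _ :=
  (n : ℕ) → (Fin (n + 1) → (ℕ → X)) → X

/-- The sequence of vectors that player II plays when following `σ` against the
moves `W 0, W 1, …` of player I. -/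
def PlayerIIStrategy.play (σ : PlayerIIStrategy X) (W : ℕ → (ℕ → X)) : ℕ → X :=
  fun n => σ n (fun i => W i)

/-- Player II has a winning strategy for the family `G` in the game in which, at move `n`,
player I plays a block subsequence `W n` of `Z` with terms in `D` and player II answers with
a vector `w n ∈ D` of the linear span of `W n`, such that `w 0 < w 1 < ⋯`. Player II wins if
the sequence `w` belongs to `G`. -/
def PlayerIIHasWinningStrategy (e : SchauderBasis ℝ X) (D : Set X) (Z : ℕ → X)
    (G : Set (ℕ → X)) : Prop :=
  ∃ σ : PlayerIIStrategy X, ∀ W : ℕ → (ℕ → X), (∀ n, W n ∈ blockSubseqs e D Z) →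
    (∀ n, σ.play W n ∈ D ∧ σ.play W n ∈ Submodule.span ℝ (Set.range (W n))) ∧
    IsBlockSeq e (σ.play W) ∧ σ.play W ∈ G

end Blocks

/-! The game is discretised to countably many moves and a G_δ payoff, a dichotomy is proved for such
games, and each alternative is carried back to X.

Write F as the range of a continuous f on ℕ^ℕ. A move is a rational combination of basis vectors
together with a bit: the vectors are to approximate f α while the bits spell out α. The plays that
meet every `closePositions e f ε n` form a G_δ set and, by continuity of f, they are block sequences
close to some f α.

For a G_δ payoff, `exists_iWins_or_iiWins` finds a subspace on which either player I wins the
asymptotic game (he only says how far out II must play) for the complement, or II wins Gowers' game.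
As there are countably many positions, a diagonal subspace decides all of them at once. If I does
not win at the start, II can pass from one position not won by I to another, meeting the open
conditions one after the other.

In the first case compactness enters: vectors of norm at most 1 with a given finite support have
finite nets and a bit has two values, so I's strategy is bounded on the relevant positions and a
sparse subsequence obeys it automatically (`exists_disjoint_of_iWins`). This is why α is coded by
bits rather than by integers. In the second case I's block sequences are replaced by rational ones
with nearby spans, and II's answers are pulled back (`playerIIHasWinningStrategy_of_iiWins`). -/

/-! ### Positions as reversed lists. -/

/-- The initial segment of length `n` of the sequence `x`, listed in reverse order. -/
def initialSegment {V : Type*} (x : ℕ → V) : ℕ → List V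
  | 0 => []
  | n + 1 => x n :: initialSegment x n

section InitialSegment

variable {V : Type*}

@[simp]
theorem length_initialSegment (x : ℕ → V) (n : ℕ) : (initialSegment x n).length = n := by
  induction n with
  | zero => rfl
  | succ n ih => simp [initialSegment, ih]

theorem drop_initialSegment (x : ℕ → V) {i j : ℕ} (h : j ≤ i) :
    (initialSegment x i).drop (i - j) = initialSegment x j := by
  obtain ⟨k, rfl⟩ := Nat.exists_eq_add_of_le h
  rw [Nat.add_sub_cancel_left]
  clear h
  induction k with
  | zero => simp
  | succ k ih => simpa [initialSegment, ← add_assoc] using ih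

theorem initialSegment_eq_of_le {x y : ℕ → V} {i j : ℕ} (h : j ≤ i)
    (hxy : initialSegment x i = initialSegment y i) :
    initialSegment x j = initialSegment y j := by
  rw [← drop_initialSegment x h, hxy, drop_initialSegment y h]

theorem eq_of_initialSegment_eq {x y : ℕ → V} {i j : ℕ} (h : j < i)
    (hxy : initialSegment x i = initialSegment y i) : x j = y j :=
  (List.cons.inj (initialSegment_eq_of_le h hxy)).1

end InitialSegment

/-! ### Abstract asymptotic and Gowers games. -/

/-- An abstract space of "subspaces" `P` and "vectors" `V` in which decreasing sequences of
subspaces admit diagonal subspaces. The set `moves X n` consists of the vectors of `X`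
beyond `n`. -/
structure FusionSystem (P V : Type*) where
  le : P → P → Prop
  almostLe : P → P → Prop
  moves : P → ℕ → Set V
  le_refl : ∀ X, le X X
  le_trans : ∀ {X Y Z}, le X Y → le Y Z → le X Z
  almostLe_of_le : ∀ {X Y}, le X Y → almostLe X Y
  le_almostLe_trans : ∀ {X Y Z}, le X Y → almostLe Y Z → almostLe X Z
  moves_nonempty : ∀ X, (moves X 0).Nonempty
  moves_mono : ∀ {X Y}, le X Y → moves X 0 ⊆ moves Y 0
  moves_antitone : ∀ X, Antitone (moves X)
  exists_moves_subset : ∀ {X Y}, almostLe X Y → ∀ n, ∃ m, moves X m ⊆ moves Y n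
  exists_common : ∀ {X Y}, almostLe X Y → ∃ Z, le Z X ∧ le Z Y
  fusion : ∀ X : ℕ → P, (∀ n, le (X (n + 1)) (X n)) → ∃ Y, le Y (X 0) ∧ ∀ n, almostLe Y (X n)

namespace FusionSystem

variable {P V : Type*} (S : FusionSystem P V)

/-- Player I has a strategy in the asymptotic game on `X` that, starting from the position `p`,
leads into `W`. -/
def IWins (X : P) (W : Set (ℕ → V)) (p : List V) : Prop :=
  ∃ σ : List V → ℕ, ∀ x : ℕ → V, initialSegment x p.length = p →
    (∀ i, p.length ≤ i → x i ∈ S.moves X (σ (initialSegment x i))) → x ∈ W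

/-- `τ` is a legal strategy for player II in Gowers' game on `X`. -/
def IsLegal (X : P) (τ : List V → P → V) : Prop :=
  ∀ l Y, S.le Y X → τ l Y ∈ S.moves Y 0

/-- From the position `p` on, the sequence `x` is played according to `τ` in Gowers' game
on `X`. -/
def Follows (X : P) (τ : List V → P → V) (p : List V) (x : ℕ → V) : Prop :=
  initialSegment x p.length = p ∧
    ∀ i, p.length ≤ i → ∃ Y, S.le Y X ∧ x i = τ (initialSegment x i) Y

/-- Player II has a strategy in Gowers' game on `X` that, starting from the position `p`,
leads into `A`. -/
def IIWins (X : P) (A : Set (ℕ → V)) (p : List V) : Prop :=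
  ∃ τ : List V → P → V, S.IsLegal X τ ∧ ∀ x, S.Follows X τ p x → x ∈ A

variable {S}

theorem exists_isLegal (X : P) : ∃ τ : List V → P → V, S.IsLegal X τ := by
  choose v hv using S.moves_nonempty
  exact ⟨fun _ Y => v Y, fun _ Y _ => hv Y⟩

theorem IWins.of_almostLe {X Y : P} {W : Set (ℕ → V)} {p : List V} (h : S.IWins X W p)
    (hYX : S.almostLe Y X) : S.IWins Y W p := by
  obtain ⟨σ, hσ⟩ := h
  choose m hm using S.exists_moves_subset hYX
  exact ⟨fun l => m (σ l), fun x hx hxi => hσ x hx fun i hi => hm _ (hxi i hi)⟩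

theorem IWins.mono {X : P} {W W' : Set (ℕ → V)} {p : List V} (h : S.IWins X W p)
    (hW : W ⊆ W') : S.IWins X W' p :=
  h.imp fun _ hσ x hx hxi => hW (hσ x hx hxi)

/-- II answers a move Z as if I had played a common subspace of Z and X, where the old strategy
applies; the answer still lies in Z. -/
theorem IIWins.of_almostLe {X Y : P} {A : Set (ℕ → V)} {p : List V} (h : S.IIWins X A p)
    (hYX : S.almostLe Y X) : S.IIWins Y A p := by
  obtain ⟨τ, hτ, hA⟩ := h
  have : ∀ Z, ∃ Z', S.le Z Y → S.le Z' Z ∧ S.le Z' X := by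
    intro Z
    by_cases hZ : S.le Z Y
    · obtain ⟨Z', h⟩ := S.exists_common (S.le_almostLe_trans hZ hYX)
      exact ⟨Z', fun _ => h⟩
    · exact ⟨Z, fun h => absurd h hZ⟩
  choose c hc using this
  refine ⟨fun l Z => τ l (c Z), fun l Z hZ => ?_, fun x hx => hA x ⟨hx.1, fun i hi => ?_⟩⟩
  · exact S.moves_mono (hc Z hZ).1 (hτ l _ (hc Z hZ).2)
  · obtain ⟨Z, hZ, hxZ⟩ := hx.2 i hi
    exact ⟨c Z, (hc Z hZ).2, hxZ⟩

/-- A countable family of properties that pass to almost smaller subspaces can be decided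
simultaneously. -/
theorem exists_decides {ι : Type*} [Countable ι] (Q : P → ι → Prop)
    (hQ : ∀ X Y i, Q X i → S.almostLe Y X → Q Y i) (X : P) :
    ∃ Y, S.le Y X ∧ ∀ i, Q Y i ∨ ∀ Z, S.le Z Y → ¬ Q Z i := by
  rcases isEmpty_or_nonempty ι with hι | hι
  · exact ⟨X, S.le_refl X, fun i => (hι.false i).elim⟩
  obtain ⟨g, hg⟩ := exists_surjective_nat ι
  have step : ∀ (n : ℕ) (X : P), ∃ Y, S.le Y X ∧ (Q Y (g n) ∨ ∀ Z, S.le Z Y → ¬ Q Z (g n)) := by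
    intro n X
    by_cases h : ∃ Y, S.le Y X ∧ Q Y (g n)
    · obtain ⟨Y, hY, hQY⟩ := h
      exact ⟨Y, hY, Or.inl hQY⟩
    · push Not at h
      exact ⟨X, S.le_refl X, Or.inr h⟩
  choose next hle hdec using step
  let Xs : ℕ → P := fun n => Nat.rec X (fun n Y => next n Y) n
  obtain ⟨Y, hY0, hY⟩ := S.fusion Xs fun n => hle n (Xs n)
  refine ⟨Y, hY0, fun i => ?_⟩
  obtain ⟨n, rfl⟩ := hg i
  rcases hdec n (Xs n) with h | h
  · exact Or.inl (hQ _ _ _ h (hY (n + 1)))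
  -- A subspace of Y with the property would pass it on to a common subspace with the n-th stage,
  -- which had excluded it.
  · refine Or.inr fun Z hZ hQZ => ?_
    obtain ⟨Z', hZ', hZX⟩ := S.exists_common (S.le_almostLe_trans hZ (hY (n + 1)))
    exact h Z' hZX (hQ _ _ _ hQZ (S.almostLe_of_le hZ'))

/-! ### Dichotomy for open games. -/

variable (S) in
/-- Player II can force the position to enter `O`, starting from the position `p`. -/
def Reaches (X : P) (O : Set (List V)) (p : List V) : Prop :=
  S.IIWins X {x | ∃ i, p.length ≤ i ∧ initialSegment x i ∈ O} p

theorem reaches_of_mem {X : P} {O : Set (List V)} {p : List V} (hp : p ∈ O) :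
    S.Reaches X O p := by
  obtain ⟨τ, hτ⟩ := S.exists_isLegal X
  exact ⟨τ, hτ, fun x hx => ⟨p.length, le_rfl, hx.1.symm ▸ hp⟩⟩

theorem reaches_of_forall_exists {X : P} {O : Set (List V)} {p : List V}
    (h : ∀ Y, S.le Y X → ∃ y ∈ S.moves Y 0, S.Reaches X O (y :: p)) : S.Reaches X O p := by
  obtain ⟨τ₀, hτ₀⟩ := S.exists_isLegal X
  have h' : ∀ Y, ∃ y, S.le Y X → y ∈ S.moves Y 0 ∧ S.Reaches X O (y :: p) := by
    intro Y
    by_cases hY : S.le Y X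
    · obtain ⟨y, hy⟩ := h Y hY
      exact ⟨y, fun _ => hy⟩
    · exact ⟨(S.moves_nonempty Y).choose, fun h => absurd h hY⟩
  choose y hy using h'
  have hT : ∀ q, ∃ τ : List V → P → V, S.IsLegal X τ ∧ (S.Reaches X O q →
      ∀ x, S.Follows X τ q x → ∃ i, q.length ≤ i ∧ initialSegment x i ∈ O) := by
    intro q
    by_cases hq : S.Reaches X O q
    · obtain ⟨τ, hτ, hx⟩ := hq
      exact ⟨τ, hτ, fun _ => hx⟩
    · exact ⟨τ₀, hτ₀, fun h => absurd h hq⟩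
  choose T hTl hTw using hT
  classical
  -- After the opening move y, II uses the strategy attached to the position of length `p.length +
  -- 1`, recovered by dropping the later moves.
  refine ⟨fun l Y => if l.length ≤ p.length then y Y
    else T (l.drop (l.length - (p.length + 1))) l Y, fun l Y hY => ?_, fun x hx => ?_⟩
  · dsimp only
    split_ifs
    · exact (hy Y hY).1
    · exact hTl _ l Y hY
  · obtain ⟨Y, hY, hxY⟩ := hx.2 p.length le_rfl
    simp only [length_initialSegment] at hxY
    rw [if_pos le_rfl] at hxY
    have hpre : initialSegment x (p.length + 1) = y Y :: p := by
      rw [initialSegment, hx.1, hxY]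
    obtain ⟨i, hi, hiO⟩ := hTw (y Y :: p) (hy Y hY).2 x ⟨hpre, fun i hi => by
      rw [List.length_cons] at hi
      obtain ⟨Z, hZ, hxZ⟩ := hx.2 i (by omega)
      refine ⟨Z, hZ, ?_⟩
      dsimp only at hxZ
      rwa [length_initialSegment, if_neg (by omega), drop_initialSegment x hi, hpre] at hxZ⟩
    exact ⟨i, (Nat.le_succ _).trans hi, hiO⟩

variable [Countable V]

/-- The dichotomy for games that are open for player II. -/
theorem exists_reaches_or_iWins {ι : Type*} [Countable ι] (O : ι → Set (List V)) (X : P) :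
    ∃ Z, S.le Z X ∧ ∀ j p, S.Reaches Z (O j) p ∨
      S.IWins Z {x | ∀ i, p.length ≤ i → initialSegment x i ∉ O j} p := by
  obtain ⟨Y, hYX, hY⟩ := S.exists_decides (fun X (q : ι × List V) => S.Reaches X (O q.1) q.2)
    (fun _ _ _ h hle => h.of_almostLe hle) X
  obtain ⟨Z, hZY, hZ⟩ := S.exists_decides
    (fun X (q : ι × List V) => ∃ m, ∀ y ∈ S.moves X m, ¬ S.Reaches Y (O q.1) (y :: q.2))
    (fun X X' _ ⟨m, hm⟩ hle => by
      obtain ⟨m', hm'⟩ := S.exists_moves_subset hle m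
      exact ⟨m', fun y hy => hm y (hm' hy)⟩) Y
  -- Otherwise every subspace of Z contains a y from which II reaches `O j`; opening with it, he
  -- would reach `O j` from q, against the choice of Y.
  have key : ∀ j q, ¬ S.Reaches Y (O j) q →
      ∃ m, ∀ y ∈ S.moves Z m, ¬ S.Reaches Y (O j) (y :: q) := by
    intro j q hq
    refine (hZ (j, q)).resolve_right fun hbad => ?_
    refine (((hY (j, q)).resolve_left hq) Z hZY) (reaches_of_forall_exists fun Z' hZ' => ?_)
    have := hbad Z' hZ'
    push Not at this
    obtain ⟨y, hy, hyY⟩ := this 0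
    exact ⟨y, hy, hyY.of_almostLe (S.almostLe_of_le hZY)⟩
  refine ⟨Z, S.le_trans hZY hYX, fun j p => ?_⟩
  by_cases hp : S.Reaches Y (O j) p
  · exact Or.inl (hp.of_almostLe (S.almostLe_of_le hZY))
  · have key' : ∀ q, ∃ m, ¬ S.Reaches Y (O j) q →
        ∀ y ∈ S.moves Z m, ¬ S.Reaches Y (O j) (y :: q) := by
      intro q
      by_cases hq : S.Reaches Y (O j) q
      · exact ⟨0, fun h => absurd hq h⟩
      · obtain ⟨m, hm⟩ := key j q hq
        exact ⟨m, fun _ => hm⟩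
    choose σ hσ using key'
    refine Or.inr ⟨σ, fun x hx hxi i hi => ?_⟩
    have : ¬ S.Reaches Y (O j) (initialSegment x i) := by
      induction i, hi using Nat.le_induction with
      | base => rwa [hx]
      | succ i hi ih => exact hσ _ ih _ (hxi i hi)
    exact fun h => this (reaches_of_mem h)

/-! ### Dichotomy for G_δ games. -/

omit [Countable V] in
/-- If player I can avoid the positions in `N ∩ O` and wins from all positions outside `N`,
then he can win or avoid `O`. -/
theorem IWins.of_avoids {Z : P} {W : Set (ℕ → V)} {N O : Set (List V)} {p : List V}
    (hN : ∀ q ∉ N, S.IWins Z W q)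
    (hp : S.IWins Z {x | ∀ i, p.length ≤ i → initialSegment x i ∉ N ∩ O} p) :
    S.IWins Z (W ∪ {x | ∀ i, p.length ≤ i → initialSegment x i ∉ O}) p := by
  obtain ⟨σ₀, hσ₀⟩ := hp
  have hN' : ∀ q, ∃ σ : List V → ℕ, q ∉ N → ∀ x : ℕ → V, initialSegment x q.length = q →
      (∀ i, q.length ≤ i → x i ∈ S.moves Z (σ (initialSegment x i))) → x ∈ W := by
    intro q
    by_cases hq : q ∈ N
    · exact ⟨fun _ => 0, fun h => absurd hq h⟩
    · obtain ⟨σ, hσ⟩ := hN q hq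
      exact ⟨σ, fun _ => hσ⟩
  choose T hT using hN'
  -- Larger numbers only restrict II, so I obeys σ₀ and the strategies of all earlier positions at
  -- once. He need not notice when the play leaves N.
  refine ⟨fun l => max (σ₀ l)
    ((Finset.range (l.length + 1)).sup fun j => T (l.drop (l.length - j)) l), fun x hx hxi => ?_⟩
  by_cases h : ∃ j, p.length ≤ j ∧ initialSegment x j ∉ N
  · obtain ⟨j, hpj, hj⟩ := h
    refine Or.inl (hT _ hj x (by simp) fun i hi => ?_)
    rw [length_initialSegment] at hi
    refine S.moves_antitone Z ?_ (hxi i (hpj.trans hi))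
    refine le_max_of_le_right ?_
    have := Finset.le_sup (f := fun j => T ((initialSegment x i).drop
      ((initialSegment x i).length - j)) (initialSegment x i))
      (Finset.mem_range.2 (by rw [length_initialSegment]; omega) :
        j ∈ Finset.range ((initialSegment x i).length + 1))
    simpa only [length_initialSegment, drop_initialSegment x hi] using this
  · push Not at h
    exact Or.inr fun i hi hO => hσ₀ x hx
      (fun i hi => S.moves_antitone Z (le_max_left _ _) (hxi i hi)) i hi ⟨h i hi, hO⟩

omit [Countable V] in
/-- If from every position in `N` player II can reach a later position in `N ∩ U n`, then he can
visit all the sets `U n`. -/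
theorem iiWins_of_reaches {Z : P} {U : ℕ → Set (List V)} {N : Set (List V)}
    (hN : ∀ p ∈ N, ∀ n, S.Reaches Z {q | q ∈ N ∧ q ∈ U n ∧ p.length < q.length} p)
    (h0 : [] ∈ N) : S.IIWins Z {x | ∀ n, ∃ i, initialSegment x i ∈ U n} [] := by
  obtain ⟨τ₀, hτ₀⟩ := S.exists_isLegal Z
  have hT : ∀ (s : List V × ℕ), ∃ τ : List V → P → V, S.IsLegal Z τ ∧ (s.1 ∈ N →
      ∀ x, S.Follows Z τ s.1 x → ∃ i, s.1.length < i ∧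
        initialSegment x i ∈ N ∧ initialSegment x i ∈ U s.2) := by
    rintro ⟨p, n⟩
    by_cases hp : p ∈ N
    · obtain ⟨τ, hτ, hx⟩ := hN p hp n
      refine ⟨τ, hτ, fun _ x hxp => ?_⟩
      obtain ⟨i, -, h1, h2, h3⟩ := hx x hxp
      exact ⟨i, by simpa using h3, h1, h2⟩
    · exact ⟨τ₀, hτ₀, fun h => absurd h hp⟩
  choose T hTl hTw using hT
  classical
  -- The state records the last position where a target was hit and the index of the next target; II
  -- plays the strategy attached to it.
  let st : List V → List V × ℕ := fun l => List.rec ([], 0)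
    (fun v l s => if v :: l ∈ N ∧ v :: l ∈ U s.2 then (v :: l, s.2 + 1) else s) l
  have st_cons : ∀ v l, st (v :: l) =
      if v :: l ∈ N ∧ v :: l ∈ U (st l).2 then (v :: l, (st l).2 + 1) else st l := fun _ _ => rfl
  refine ⟨fun l Y => T (st l) l Y, fun l Y hY => hTl _ l Y hY, fun x hx => ?_⟩
  have hfol : ∀ i, ∃ Y, S.le Y Z ∧ x i = T (st (initialSegment x i)) (initialSegment x i) Y :=
    fun i => hx.2 i (Nat.zero_le i)
  have step : ∀ n i, st (initialSegment x i) = (initialSegment x i, n) → initialSegment x i ∈ N →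
      ∃ k, initialSegment x k ∈ N ∧ initialSegment x k ∈ U n ∧
        st (initialSegment x k) = (initialSegment x k, n + 1) := by
    intro n i hst hi
    have stay : ∀ k, i ≤ k → (∀ j, i < j → j ≤ k →
        ¬ (initialSegment x j ∈ N ∧ initialSegment x j ∈ U n)) →
        st (initialSegment x k) = (initialSegment x i, n) := by
      intro k hk
      induction k, hk using Nat.le_induction with
      | base => exact fun _ => hst
      | succ k hk ih =>
        intro h
        have ih' := ih fun j hj hjk => h j hj (by omega)
        have := h (k + 1) (by omega) le_rfl
        rw [initialSegment] at this ⊢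
        rw [st_cons, ih', if_neg this]
    -- Without a hit the state never changes, so the play follows a single strategy, which
    -- guarantees a hit.
    have hex : ∃ k, i < k ∧ initialSegment x k ∈ N ∧ initialSegment x k ∈ U n := by
      by_contra! hno
      obtain ⟨k, hk, hkN, hkU⟩ := hTw (initialSegment x i, n) hi x ⟨by simp, fun k hk => by
        simp only [length_initialSegment] at hk
        have := stay k hk fun j hj _ h => hno j hj h.1 h.2
        obtain ⟨Y, hY, hxY⟩ := hfol k
        rw [this] at hxY
        exact ⟨Y, hY, hxY⟩⟩
      simp only [length_initialSegment] at hk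
      exact hno k hk hkN hkU
    obtain ⟨hik, hkN, hkU⟩ := Nat.find_spec hex
    have hmin := fun j => Nat.find_min (H := hex) (m := j)
    generalize Nat.find hex = k at hik hkN hkU hmin
    obtain ⟨k, rfl⟩ : ∃ k', k = k' + 1 := ⟨k - 1, by omega⟩
    refine ⟨k + 1, hkN, hkU, ?_⟩
    have := stay k (by omega) fun j hj hjk h => hmin j (by omega) ⟨hj, h⟩
    rw [initialSegment] at hkN hkU ⊢
    rw [st_cons, this, if_pos ⟨hkN, hkU⟩]
  have all : ∀ n, ∃ i, initialSegment x i ∈ N ∧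
      st (initialSegment x i) = (initialSegment x i, n) := by
    intro n
    induction n with
    | zero => exact ⟨0, h0, rfl⟩
    | succ n ih =>
      obtain ⟨i, hi, hst⟩ := ih
      obtain ⟨k, hk, -, hst'⟩ := step n i hst hi
      exact ⟨k, hk, hst'⟩
  intro n
  obtain ⟨i, hi, hst⟩ := all n
  obtain ⟨k, -, hk, -⟩ := step n i hst hi
  exact ⟨k, hk⟩

/-- The dichotomy for games that are `G_δ` for player II. -/
theorem exists_iWins_or_iiWins (U : ℕ → Set (List V))
    (hU : ∀ n v l, l ∈ U n → v :: l ∈ U n) (X : P) :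
    ∃ Z, S.le Z X ∧ (S.IWins Z {x | ∀ n, ∃ i, initialSegment x i ∈ U n}ᶜ [] ∨
      S.IIWins Z {x | ∀ n, ∃ i, initialSegment x i ∈ U n} []) := by
  set W : Set (ℕ → V) := {x | ∀ n, ∃ i, initialSegment x i ∈ U n}ᶜ with hW
  obtain ⟨Y, hYX, hY⟩ := S.exists_decides (fun X p => S.IWins X W p)
    (fun _ _ _ h hle => h.of_almostLe hle) X
  by_cases h0 : S.IWins Y W []
  · exact ⟨Y, hYX, Or.inl h0⟩
  obtain ⟨Z, hZY, hZ⟩ := exists_reaches_or_iWins (S := S) (fun q : ℕ × ℕ =>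
    {l : List V | ¬ S.IWins Y W l} ∩ {l | l ∈ U q.1 ∧ q.2 < l.length}) Y
  refine ⟨Z, S.le_trans hZY hYX, Or.inr (iiWins_of_reaches (N := {l | ¬ S.IWins Y W l})
    (fun p hp n => ?_) h0)⟩
  refine (hZ (n, p.length) p).resolve_right fun hI => ?_
  -- If I could avoid the target, then either the play leaves N, where I wins, or it never lies in
  -- `U n` beyond p and so misses the G_δ set. Thus I would win from p.
  refine (hY p).resolve_left hp Z hZY ((IWins.of_avoids (W := W) (fun q hq => ?_) hI).mono ?_)
  · exact (not_not.1 hq).of_almostLe (S.almostLe_of_le hZY)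
  · rintro x (hx | hx)
    · exact hx
    · have mono : ∀ i j, i ≤ j → initialSegment x i ∈ U n → initialSegment x j ∈ U n := by
        intro i j hij hi
        induction j, hij using Nat.le_induction with
        | base => exact hi
        | succ j _ ih => exact hU n _ _ ih
      intro hall
      obtain ⟨i, hi⟩ := hall n
      exact hx (max i (p.length + 1)) (le_max_of_le_right (Nat.le_succ _))
        ⟨mono _ _ (le_max_left _ _) hi, by simp⟩

end FusionSystem

/-! ### Block sequences and rational vectors. -/

section BlockSequences

variable {X : Type*} [NormedAddCommGroup X] [NormedSpace ℝ X] {e : SchauderBasis ℝ X}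

theorem eq_zero_of_forall_coord_eq_zero {x : X} (h : ∀ i, e.coord i x = 0) : x = 0 := by
  refine tendsto_nhds_unique (SchauderBasis.tendsto_proj e x) ?_
  simp [h]

theorem basisSupport_nonempty {x : X} (hx : x ≠ 0) : (basisSupport e x).Nonempty := by
  by_contra h
  refine hx (eq_zero_of_forall_coord_eq_zero (e := e) fun i => ?_)
  by_contra hi
  exact h ⟨i, hi⟩

theorem ne_zero_of_mem_basisSupport {x : X} {i : ℕ} (h : i ∈ basisSupport e x) : x ≠ 0 := by
  rintro rfl
  exact h (map_zero _)

theorem basisSupport_smul {a : ℝ} (ha : a ≠ 0) (x : X) :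
    basisSupport e (a • x) = basisSupport e x := by
  ext i
  simp [basisSupport, ha]

theorem BlockLT.congr {x x' y y' : X} (h : BlockLT e x y)
    (hx : basisSupport e x' = basisSupport e x) (hy : basisSupport e y' = basisSupport e y) :
    BlockLT e x' y' := by
  obtain ⟨i, hi⟩ := basisSupport_nonempty (e := e) h.1
  obtain ⟨j, hj⟩ := basisSupport_nonempty (e := e) h.2.1
  refine ⟨ne_zero_of_mem_basisSupport (hx ▸ hi), ne_zero_of_mem_basisSupport (hy ▸ hj), ?_⟩
  rw [hx, hy]
  exact h.2.2

theorem BlockLT.trans {x y z : X} (hxy : BlockLT e x y) (hyz : BlockLT e y z) :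
    BlockLT e x z := by
  obtain ⟨j, hj⟩ := basisSupport_nonempty (e := e) hyz.1
  exact ⟨hxy.1, hyz.2.1, fun i hi k hk => (hxy.2.2 i hi j hj).trans (hyz.2.2 j hj k hk)⟩

namespace IsBlockSeq

variable {U : ℕ → X}

theorem blockLT (hU : IsBlockSeq e U) {i j : ℕ} (h : i < j) : BlockLT e (U i) (U j) := by
  induction j, h using Nat.le_induction with
  | base => exact hU i
  | succ j _ ih => exact ih.trans (hU j)

theorem ne_zero (hU : IsBlockSeq e U) (i : ℕ) : U i ≠ 0 :=
  (hU i).1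

theorem lt_of_mem (hU : IsBlockSeq e U) {i j k l : ℕ} (h : i < j)
    (hk : k ∈ basisSupport e (U i)) (hl : l ∈ basisSupport e (U j)) : k < l :=
  (hU.blockLT h).2.2 k hk l hl

theorem index_le_of_mem (hU : IsBlockSeq e U) {i k : ℕ} (hk : k ∈ basisSupport e (U i)) :
    i ≤ k := by
  induction i generalizing k with
  | zero => exact Nat.zero_le k
  | succ i ih =>
    obtain ⟨l, hl⟩ := basisSupport_nonempty (e := e) (hU.ne_zero i)
    exact (ih hl).trans_lt (hU.lt_of_mem (Nat.lt_succ_self i) hl hk)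

theorem index_eq_of_mem (hU : IsBlockSeq e U) {i j k : ℕ} (hi : k ∈ basisSupport e (U i))
    (hj : k ∈ basisSupport e (U j)) : i = j := by
  rcases lt_trichotomy i j with h | h | h
  · exact absurd (hU.lt_of_mem h hi hj) (lt_irrefl k)
  · exact h
  · exact absurd (hU.lt_of_mem h hj hi) (lt_irrefl k)

theorem exists_support_lt (hU : IsBlockSeq e U) (m : ℕ) :
    ∃ N, ∀ i < m, ∀ k ∈ basisSupport e (U i), k < N := by
  obtain ⟨N, hN⟩ := basisSupport_nonempty (e := e) (hU.ne_zero m)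
  exact ⟨N, fun i hi k hk => hU.lt_of_mem hi hk hN⟩

theorem comp_strictMono (hU : IsBlockSeq e U) {φ : ℕ → ℕ} (hφ : StrictMono φ) :
    IsBlockSeq e (U ∘ φ) :=
  fun n => hU.blockLT (hφ (Nat.lt_succ_self n))

theorem coord_sum (hU : IsBlockSeq e U) {s : Finset ℕ} (c : ℕ → ℝ) {i k : ℕ} (hi : i ∈ s)
    (hk : k ∈ basisSupport e (U i)) :
    e.coord k (∑ j ∈ s, c j • U j) = c i * e.coord k (U i) := by
  rw [map_sum, Finset.sum_eq_single_of_mem i hi, map_smul, smul_eq_mul]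
  intro j _ hji
  rw [map_smul, smul_eq_mul]
  by_cases h : e.coord k (U j) = 0
  · rw [h, mul_zero]
  · exact absurd (hU.index_eq_of_mem h hk) hji

theorem basisSupport_sum (hU : IsBlockSeq e U) {s : Finset ℕ} {c : ℕ → ℝ}
    (hc : ∀ i ∈ s, c i ≠ 0) :
    basisSupport e (∑ j ∈ s, c j • U j) = ⋃ i ∈ s, basisSupport e (U i) := by
  ext k
  simp only [Set.mem_iUnion, exists_prop]
  constructor
  · intro hk
    change e.coord k _ ≠ 0 at hk
    rw [map_sum] at hk
    obtain ⟨i, hi, hne⟩ := Finset.exists_ne_zero_of_sum_ne_zero hk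
    refine ⟨i, hi, fun h => hne ?_⟩
    rw [map_smul, h, smul_zero]
  · rintro ⟨i, hi, hk⟩
    change e.coord k _ ≠ 0
    rw [hU.coord_sum c hi hk]
    exact mul_ne_zero (hc i hi) hk

end IsBlockSeq

theorem exists_sum_of_mem_span {U : ℕ → X} {v : X} (hv : v ∈ Submodule.span ℝ (Set.range U)) :
    ∃ (s : Finset ℕ) (c : ℕ → ℝ), (∀ i ∈ s, c i ≠ 0) ∧ v = ∑ i ∈ s, c i • U i := by
  obtain ⟨c, rfl⟩ := Finsupp.mem_span_range_iff_exists_finsupp.1 hv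
  exact ⟨c.support, c, fun i hi => Finsupp.mem_support_iff.1 hi, rfl⟩

theorem sum_smul_mem_span {U : ℕ → X} (s : Finset ℕ) (c : ℕ → ℝ) :
    ∑ i ∈ s, c i • U i ∈ Submodule.span ℝ (Set.range U) :=
  Submodule.sum_mem _ fun i _ => Submodule.smul_mem _ _ (Submodule.subset_span ⟨i, rfl⟩)

theorem mem_span_range_of_forall {U W : ℕ → X} {v : X}
    (hW : ∀ n, W n ∈ Submodule.span ℝ (Set.range U))
    (hv : v ∈ Submodule.span ℝ (Set.range W)) : v ∈ Submodule.span ℝ (Set.range U) :=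
  Submodule.span_le.2 (Set.range_subset_iff.2 hW) hv

/-- Disjoint supports prevent cancellation: the support of v contains that of every `U i` occurring
in it, so no index below m occurs. -/
theorem IsBlockSeq.mem_of_support_ge {U : ℕ → X} (hU : IsBlockSeq e U) {m N : ℕ}
    (hN : ∀ i < m, ∀ k ∈ basisSupport e (U i), k < N) {M : Submodule ℝ X}
    (hM : ∀ i, m ≤ i → U i ∈ M) {v : X} (hv : v ∈ Submodule.span ℝ (Set.range U))
    (hvN : ∀ k ∈ basisSupport e v, N ≤ k) : v ∈ M := by
  obtain ⟨s, c, hc, rfl⟩ := exists_sum_of_mem_span hv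
  refine Submodule.sum_mem _ fun i hi => Submodule.smul_mem _ _ (hM i ?_)
  by_contra h
  obtain ⟨k, hk⟩ := basisSupport_nonempty (e := e) (hU.ne_zero i)
  refine absurd (hN i (not_le.1 h) k hk) (not_lt.2 (hvN k ?_))
  rw [hU.basisSupport_sum hc]
  exact Set.mem_biUnion hi hk

variable (e) in
/-- The finite linear combinations of the basis vectors with rational coefficients. -/
def rationalVectors : Set X :=
  Set.range fun q : ℕ →₀ ℚ => q.sum fun i a => (a : ℝ) • e i

variable (e) in
theorem countable_rationalVectors : (rationalVectors e).Countable :=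
  Set.countable_range _

theorem basis_mem_rationalVectors (n : ℕ) : e n ∈ rationalVectors e :=
  ⟨Finsupp.single n 1, by simp⟩

theorem zero_mem_rationalVectors : (0 : X) ∈ rationalVectors e :=
  ⟨0, by simp⟩

theorem add_mem_rationalVectors {x y : X} (hx : x ∈ rationalVectors e)
    (hy : y ∈ rationalVectors e) : x + y ∈ rationalVectors e := by
  obtain ⟨p, rfl⟩ := hx
  obtain ⟨q, rfl⟩ := hy
  exact ⟨p + q, Finsupp.sum_add_index' (by simp) fun i a b => by
    rw [Rat.cast_add, add_smul]⟩

theorem smul_mem_rationalVectors (a : ℚ) {x : X} (hx : x ∈ rationalVectors e) :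
    (a : ℝ) • x ∈ rationalVectors e := by
  obtain ⟨p, rfl⟩ := hx
  refine ⟨a • p, ?_⟩
  dsimp only
  rw [Finsupp.sum_smul_index (by simp), Finsupp.smul_sum]
  simp [mul_smul]

theorem sum_mem_rationalVectors {U : ℕ → X} (hU : ∀ n, U n ∈ rationalVectors e)
    (s : Finset ℕ) (q : ℕ → ℚ) : ∑ i ∈ s, (q i : ℝ) • U i ∈ rationalVectors e := by
  classical
  induction s using Finset.induction_on with
  | empty => simpa using zero_mem_rationalVectors
  | insert i s hi ih =>
    rw [Finset.sum_insert hi]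
    exact add_mem_rationalVectors (smul_mem_rationalVectors _ (hU i)) ih

theorem exists_rat_ne_zero_near {c η : ℝ} (hc : c ≠ 0) (hη : 0 < η) :
    ∃ q : ℚ, (q : ℝ) ≠ 0 ∧ |(q : ℝ) - c| ≤ η := by
  rcases lt_or_gt_of_ne hc with h | h
  · obtain ⟨q, h1, h2⟩ := exists_rat_btwn (lt_min h (lt_add_of_pos_right c hη))
    rw [lt_min_iff] at h2
    exact ⟨q, h2.1.ne, abs_le.2 ⟨by linarith, by linarith⟩⟩
  · obtain ⟨q, h1, h2⟩ := exists_rat_btwn (lt_add_of_pos_right c hη)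
    exact ⟨q, (h.trans h1).ne', abs_le.2 ⟨by linarith, by linarith⟩⟩

/-- Vectors in the span of a block sequence of rational vectors are approximated by rational
vectors in this span that have the same support. -/
theorem exists_rationalVector_near {U : ℕ → X} (hU : IsBlockSeq e U)
    (hUD : ∀ n, U n ∈ rationalVectors e) {v : X} (hv : v ∈ Submodule.span ℝ (Set.range U))
    {θ : ℝ} (hθ : 0 < θ) :
    ∃ d ∈ rationalVectors e, d ∈ Submodule.span ℝ (Set.range U) ∧
      basisSupport e d = basisSupport e v ∧ ‖d - v‖ ≤ θ := by
  obtain ⟨s, c, hc, rfl⟩ := exists_sum_of_mem_span hv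
  have hC : 0 < ∑ i ∈ s, ‖U i‖ + 1 := by positivity
  have : ∀ i, ∃ q : ℚ, i ∈ s → (q : ℝ) ≠ 0 ∧ |(q : ℝ) - c i| ≤ θ / (∑ i ∈ s, ‖U i‖ + 1) := by
    intro i
    by_cases hi : i ∈ s
    · obtain ⟨q, hq⟩ := exists_rat_ne_zero_near (hc i hi) (div_pos hθ hC)
      exact ⟨q, fun _ => hq⟩
    · exact ⟨0, fun h => absurd h hi⟩
  choose q hq using this
  refine ⟨_, sum_mem_rationalVectors hUD s q, sum_smul_mem_span s fun i => (q i : ℝ), ?_, ?_⟩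
  · rw [hU.basisSupport_sum hc, hU.basisSupport_sum (c := fun i => (q i : ℝ))
      fun i hi => (hq i hi).1]
  · rw [← Finset.sum_sub_distrib]
    calc ‖∑ i ∈ s, ((q i : ℝ) • U i - c i • U i)‖
        ≤ ∑ i ∈ s, θ / (∑ i ∈ s, ‖U i‖ + 1) * ‖U i‖ := by
          refine norm_sum_le_of_le s fun i hi => ?_
          rw [← sub_smul, norm_smul, Real.norm_eq_abs]
          exact mul_le_mul_of_nonneg_right (hq i hi).2 (norm_nonneg _)
      _ = θ * ((∑ i ∈ s, ‖U i‖) / (∑ i ∈ s, ‖U i‖ + 1)) := by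
          rw [← Finset.mul_sum]; ring
      _ ≤ θ := by
          refine mul_le_of_le_one_right hθ.le ((div_le_one hC).2 (by linarith))

variable (e) in
theorem isBlockSeq_basis : IsBlockSeq e e := by
  intro n
  have hcoord : ∀ i j, i ∈ basisSupport e (e j) → i = j := by
    intro i j h
    by_contra hij
    exact h (by simp [e.ortho, hij])
  have hne : ∀ j, e j ≠ 0 := fun j => ne_zero_of_mem_basisSupport (e := e) (i := j) (by
    change e.coord j (e j) ≠ 0
    simp [e.ortho])
  refine ⟨hne n, hne (n + 1), fun i hi j hj => ?_⟩
  rw [hcoord i n hi, hcoord j _ hj]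
  exact Nat.lt_succ_self n

variable (e) in
/-- The block sequences of rational vectors, ordered by the inclusion of their spans. A move
consists of a rational vector and a bit. -/
def rationalBlockSystem : FusionSystem (blockSeqs e (rationalVectors e))
    (rationalVectors e × Bool) where
  le Y Z := ∀ n, Y.1 n ∈ Submodule.span ℝ (Set.range Z.1)
  almostLe Y Z := ∃ m, ∀ n, m ≤ n → Y.1 n ∈ Submodule.span ℝ (Set.range Z.1)
  -- Moves may be zero or overlap earlier ones; block position is imposed by the payoff through
  -- `IsCloseUpTo`.
  moves Y n := {v | (v.1 : X) ∈ Submodule.span ℝ (Set.range Y.1) ∧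
    ∀ k ∈ basisSupport e (v.1 : X), n ≤ k}
  le_refl Y n := Submodule.subset_span ⟨n, rfl⟩
  le_trans h h' n := mem_span_range_of_forall h' (h n)
  almostLe_of_le h := ⟨0, fun n _ => h n⟩
  le_almostLe_trans := by
    rintro X Y Z h ⟨m, hm⟩
    obtain ⟨N, hN⟩ := Y.2.1.exists_support_lt m
    exact ⟨N, fun n hn => Y.2.1.mem_of_support_ge hN hm (h n) fun k hk =>
      hn.trans (X.2.1.index_le_of_mem hk)⟩
  moves_nonempty Y := ⟨(⟨Y.1 0, Y.2.2 0⟩, true), Submodule.subset_span ⟨0, rfl⟩,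
    fun k _ => Nat.zero_le k⟩
  moves_mono h v hv := ⟨mem_span_range_of_forall h hv.1, hv.2⟩
  moves_antitone Y m n hmn v hv := ⟨hv.1, fun k hk => hmn.trans (hv.2 k hk)⟩
  exists_moves_subset := by
    rintro X Y ⟨m, hm⟩ n
    obtain ⟨N, hN⟩ := X.2.1.exists_support_lt m
    exact ⟨max n N, fun v hv => ⟨X.2.1.mem_of_support_ge hN hm hv.1 fun k hk =>
      (le_max_right _ _).trans (hv.2 k hk), fun k hk => (le_max_left _ _).trans (hv.2 k hk)⟩⟩
  exists_common := by
    rintro X Y ⟨m, hm⟩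
    refine ⟨⟨X.1 ∘ fun n => n + m, X.2.1.comp_strictMono fun a b h => Nat.add_lt_add_right h m,
      fun n => X.2.2 _⟩, fun n => Submodule.subset_span ⟨n + m, rfl⟩, fun n => hm _ (Nat.le_add_left m n)⟩
  fusion := by
    intro Y hY
    have hle : ∀ m n, m ≤ n → ∀ k, (Y n).1 k ∈ Submodule.span ℝ (Set.range (Y m).1) := by
      intro m n hmn
      induction n, hmn using Nat.le_induction with
      | base => exact fun k => Submodule.subset_span ⟨k, rfl⟩
      | succ n _ ih => exact fun k => mem_span_range_of_forall ih (hY n k)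
    -- Diagonal sequence: each new term comes from a later `Y n`, far enough out to lie beyond all
    -- supports used so far.
    obtain ⟨f, -, hf⟩ := exists_seq_of_forall_finset_exists (fun _ : ℕ × ℕ => True)
      (fun a b => a.1 < b.1 ∧ BlockLT e ((Y a.1).1 a.2) ((Y b.1).1 b.2)) (by
        intro s _
        have hbd : ∀ a : ℕ × ℕ, ∃ N, ∀ k ∈ basisSupport e ((Y a.1).1 a.2), k < N := fun a => by
          obtain ⟨N, hN⟩ := (Y a.1).2.1.exists_support_lt (a.2 + 1)
          exact ⟨N, hN a.2 (Nat.lt_succ_self _)⟩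
        choose N hN using hbd
        refine ⟨(s.sup Prod.fst + 1, s.sup N), trivial, fun a ha =>
          ⟨Nat.lt_succ_of_le (Finset.le_sup (f := Prod.fst) ha), (Y _).2.1.ne_zero _,
            (Y _).2.1.ne_zero _, fun i hi j hj => (hN a i hi).trans_le ?_⟩⟩
        exact (Finset.le_sup (f := N) ha).trans ((Y _).2.1.index_le_of_mem hj))
    have hf1 : ∀ n, n ≤ (f n).1 :=
      fun n => StrictMono.le_apply (f := fun n => (f n).1) fun m n h => (hf m n h).1
    refine ⟨⟨fun n => (Y (f n).1).1 (f n).2, fun n => (hf _ _ (Nat.lt_succ_self n)).2,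
      fun n => (Y _).2.2 _⟩, fun n => hle 0 _ (Nat.zero_le _) _, fun n => ⟨n, fun k hk =>
      hle n _ (hk.trans (hf1 k)) _⟩⟩

end BlockSequences

/-! ### Coding the analytic set by bits. -/

section Coding

/-- The sequence of natural numbers coded by an infinite binary sequence. -/
noncomputable def bitDecode (b : ℕ → Bool) (k : ℕ) : ℕ :=
  (Nat.nth (fun i => b i = true) k).unpair.1

/-- Continuity of decoding: the k-th true bit lies below i, where both sequences agree. -/
theorem bitDecode_eq_of_agree {b b' : ℕ → Bool} {i k : ℕ} (h : ∀ j < i, b j = b' j)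
    (hk : k < Nat.count (fun j => b j = true) i) : bitDecode b k = bitDecode b' k := by
  have hlt : Nat.nth (fun j => b j = true) k < i := Nat.nth_lt_of_lt_count hk
  have hfin : ∀ hf : {j | b j = true}.Finite, k < hf.toFinset.card := fun hf =>
    hk.trans_le (Nat.count_le_card hf i)
  have hmem : b (Nat.nth (fun j => b j = true) k) = true := Nat.nth_mem k hfin
  have hcount : Nat.count (fun j => b j = true) (Nat.nth (fun j => b j = true) k) = k :=
    Nat.count_nth hfin
  set m := Nat.nth (fun j => b j = true) k with hm
  have hcount' : Nat.count (fun j => b' j = true) m = k := by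
    rw [← hcount, Nat.count_eq_card_filter_range, Nat.count_eq_card_filter_range]
    congr 1
    refine Finset.filter_congr fun j hj => ?_
    rw [h j ((Finset.mem_range.1 hj).trans hlt)]
  have hmem' : b' m = true := (h m hlt).symm.trans hmem
  have := Nat.nth_count (p := fun j => b' j = true) hmem'
  rw [hcount'] at this
  rw [bitDecode, bitDecode, this]

theorem exists_bitDecode_eq (α : ℕ → ℕ) :
    ∃ b : ℕ → Bool, {i | b i = true}.Infinite ∧ bitDecode b = α := by
  -- The n-th true bit sits at a pair with first component `α n`; the free second component exceeds
  -- the previous position, so positions increase.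
  let m : ℕ → ℕ := fun n => Nat.rec (Nat.pair (α 0) 0) (fun n k => Nat.pair (α (n + 1)) (k + 1)) n
  have hm : StrictMono m := strictMono_nat_of_lt_succ fun n =>
    (Nat.lt_succ_self _).trans_le (Nat.right_le_pair (α (n + 1)) (m n + 1))
  have hα : ∀ n, (m n).unpair.1 = α n := by
    rintro (_ | n)
    · exact congrArg Prod.fst (Nat.unpair_pair _ _)
    · exact congrArg Prod.fst (Nat.unpair_pair _ _)
  classical
  have hset : {i | decide (i ∈ Set.range m) = true} = Set.range m := by
    ext i
    simp
  have hinf : {i | decide (i ∈ Set.range m) = true}.Infinite := by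
    rw [hset]
    exact Set.infinite_range_of_injective hm.injective
  refine ⟨fun i => decide (i ∈ Set.range m), hinf, ?_⟩
  have : Nat.nth (fun i => decide (i ∈ Set.range m) = true) = m := by
    rw [← StrictMono.range_inj (Nat.nth_strictMono hinf) hm, Nat.range_nth_of_infinite hinf, hset]
  funext k
  rw [bitDecode, this, hα]

variable {X : Type*} [NormedAddCommGroup X] [NormedSpace ℝ X] {e : SchauderBasis ℝ X}

/-- The first `n` vectors of `x` are blocks close to the vectors of the sequence that is coded
by the bits of `x`. -/
def IsCloseUpTo (f : (ℕ → ℕ) → ℕ → X) (ε : ℕ → ℝ) (x : ℕ → rationalVectors e × Bool)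
    (n : ℕ) : Prop :=
  ∀ j < n, BlockLT e (x j).1 (x (j + 1)).1 ∧
    ‖((x j).1 : X) - f (bitDecode fun i => (x i).2) j‖ ≤ ε j

/-- The positions from which one can continue to a sequence whose first `n` vectors are close
to a sequence that extends the part of the code played so far, which is longer than `n`. -/
def closePositions (e : SchauderBasis ℝ X) (f : (ℕ → ℕ) → ℕ → X) (ε : ℕ → ℝ) (n : ℕ) :
    Set (List (rationalVectors e × Bool)) :=
  {l | ∃ x i, initialSegment x i <:+ l ∧ n < Nat.count (fun j => (x j).2 = true) i ∧
    IsCloseUpTo f ε x n}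

theorem cons_mem_closePositions (f : (ℕ → ℕ) → ℕ → X) (ε : ℕ → ℝ) (n : ℕ)
    (v : rationalVectors e × Bool) (l : List (rationalVectors e × Bool))
    (hl : l ∈ closePositions e f ε n) : v :: l ∈ closePositions e f ε n := by
  obtain ⟨x, i, h, h'⟩ := hl
  exact ⟨x, i, h.trans (List.suffix_cons v l), h'⟩

theorem exists_initialSegment_mem_closePositions {f : (ℕ → ℕ) → ℕ → X} {ε : ℕ → ℝ}
    {x : ℕ → rationalVectors e × Bool} (hx : {i | (x i).2 = true}.Infinite)
    (hclose : ∀ n, IsCloseUpTo f ε x n) (n : ℕ) :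
    ∃ i, initialSegment x i ∈ closePositions e f ε n :=
  ⟨Nat.nth (fun i => (x i).2 = true) n + 1, x, _, List.suffix_rfl, by
    rw [Nat.count_nth_succ_of_infinite hx]
    exact Nat.lt_succ_self n, hclose n⟩

open Filter Topology in
-- The n-th witness agrees with x until more than n entries of the code are fixed. Hence the codes
-- of the witnesses converge to that of x, and continuity of f carries the norm bounds to the limit.
theorem close_of_forall_exists_mem_closePositions {f : (ℕ → ℕ) → ℕ → X} (hf : Continuous f)
    {ε : ℕ → ℝ} {x : ℕ → rationalVectors e × Bool}
    (hx : ∀ n, ∃ i, initialSegment x i ∈ closePositions e f ε n) :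
    IsBlockSeq e (fun n => ((x n).1 : X)) ∧
      ∃ α, ∀ n, ‖((x n).1 : X) - f α n‖ ≤ ε n := by
  choose i y k hyk hcount hclose using hx
  have hagree : ∀ n, ∀ j < k n, x j = y n j := by
    intro n j hj
    have hle := (hyk n).length_le
    have hdrop := List.suffix_iff_eq_drop.1 (hyk n)
    simp only [length_initialSegment] at hle hdrop
    rw [drop_initialSegment x hle] at hdrop
    exact eq_of_initialSegment_eq hj hdrop.symm
  have hlt : ∀ n, n < k n := fun n => (hcount n).trans_le (Nat.count_le _)
  refine ⟨fun n => ?_, bitDecode fun i => (x i).2, fun n => ?_⟩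
  · have := (hclose (n + 1) n (Nat.lt_succ_self n)).1
    rwa [← hagree (n + 1) n ((Nat.lt_succ_self n).trans (hlt _)),
      ← hagree (n + 1) (n + 1) (hlt _)] at this
  · have hcode : ∀ N, ∀ j ≤ N, bitDecode (fun i => (y N i).2) j =
        bitDecode (fun i => (x i).2) j := by
      intro N j hj
      exact bitDecode_eq_of_agree (fun l hl => by rw [hagree N l hl]) (hj.trans_lt (hcount N))
    have htend : Tendsto (fun N => bitDecode fun i => (y N i).2) atTop
        (𝓝 (bitDecode fun i => (x i).2)) :=
      tendsto_pi_nhds.2 fun j => tendsto_const_nhds.congr'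
        ((eventually_ge_atTop j).mono fun N hN => (hcode N j hN).symm)
    have hlim : Tendsto (fun N => ‖((x n).1 : X) - f (bitDecode fun i => (y N i).2) n‖) atTop
        (𝓝 ‖((x n).1 : X) - f (bitDecode fun i => (x i).2) n‖) :=
      (tendsto_const_nhds.sub
        ((((continuous_apply n).comp hf).tendsto _).comp htend)).norm
    refine le_of_tendsto hlim ((eventually_gt_atTop n).mono fun N hN => ?_)
    have := (hclose N n hN).2
    rwa [← hagree N n (hN.trans (hlt N))] at this

end Coding

/-! ### From player I's strategy to a disjoint block sequence. -/

section AsymptoticGame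

variable {X : Type*} [NormedAddCommGroup X] [NormedSpace ℝ X] {e : SchauderBasis ℝ X}

/-- Such vectors lie in the unit ball of the finite-dimensional span of the `e i` with i in K. -/
theorem totallyBounded_basisSupport_eq (K : Finset ℕ) :
    TotallyBounded {v : X | basisSupport e v = K ∧ ‖v‖ ≤ 1} := by
  let M : Submodule ℝ X := Submodule.span ℝ (e '' K)
  have : FiniteDimensional ℝ M := FiniteDimensional.span_of_finite ℝ (K.finite_toSet.image e)
  have : ProperSpace M := FiniteDimensional.proper_real M
  refine ((isCompact_closedBall (0 : M) 1).totallyBounded.image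
    uniformContinuous_subtype_val).subset ?_
  rintro v ⟨hK, hv⟩
  have hsum : v = ∑ i ∈ K, e.coord i v • e i := by
    refine sub_eq_zero.1 (eq_zero_of_forall_coord_eq_zero (e := e) fun i => ?_)
    have hi : i ∉ K → e.coord i v = 0 := fun hi => by
      by_contra h
      exact hi (Finset.mem_coe.1 (hK ▸ (show i ∈ basisSupport e v from h)))
    simpa [e.ortho, Pi.single_apply, sub_eq_zero] using hi
  have hM : v ∈ M := by
    rw [hsum]
    exact Submodule.sum_mem _ fun i hi => Submodule.smul_mem _ _
      (Submodule.subset_span ⟨i, hi, rfl⟩)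
  exact ⟨⟨v, hM⟩, by simpa using hv, rfl⟩

/-- Finite nets of rational vectors for the vectors with prescribed support. -/
theorem exists_finset_net {U : ℕ → X} (hU : U ∈ blockSeqs e (rationalVectors e)) (K : Finset ℕ)
    {δ : ℝ} (hδ : 0 < δ) :
    ∃ N : Finset (rationalVectors e), ∀ v ∈ Submodule.span ℝ (Set.range U),
      basisSupport e v = K → ‖v‖ ≤ 1 → ∃ d ∈ N, (d : X) ∈ Submodule.span ℝ (Set.range U) ∧
        basisSupport e (d : X) = K ∧ ‖(d : X) - v‖ ≤ δ := by
  have htb : TotallyBounded {v : X | v ∈ Submodule.span ℝ (Set.range U) ∧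
      basisSupport e v = K ∧ ‖v‖ ≤ 1} :=
    (totallyBounded_basisSupport_eq K).subset fun v hv => hv.2
  obtain ⟨t, ht, htfin, hcover⟩ := Metric.finite_approx_of_totallyBounded htb (δ / 2) (half_pos hδ)
  have : ∀ u, ∃ d : rationalVectors e, u ∈ t → (d : X) ∈ Submodule.span ℝ (Set.range U) ∧
      basisSupport e (d : X) = K ∧ ‖(d : X) - u‖ ≤ δ / 2 := by
    intro u
    by_cases hu : u ∈ t
    · obtain ⟨d, hd, h1, h2, h3⟩ := exists_rationalVector_near hU.1 hU.2 (ht hu).1 (half_pos hδ)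
      exact ⟨⟨d, hd⟩, fun _ => ⟨h1, h2.trans (ht hu).2.1, h3⟩⟩
    · exact ⟨⟨0, zero_mem_rationalVectors⟩, fun h => absurd h hu⟩
  choose d hd using this
  classical
  refine ⟨htfin.toFinset.image d, fun v hv hvK hv1 => ?_⟩
  obtain ⟨u, hu, huv⟩ := Set.mem_iUnion₂.1 (hcover ⟨hv, hvK, hv1⟩)
  refine ⟨d u, Finset.mem_image_of_mem d (htfin.mem_toFinset.2 hu), (hd u hu).1, (hd u hu).2.1, ?_⟩
  rw [Metric.mem_ball, dist_eq_norm] at huv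
  calc ‖(d u : X) - v‖ ≤ ‖(d u : X) - u‖ + ‖u - v‖ := norm_sub_le_norm_sub_add_norm_sub _ _ _
    _ ≤ δ / 2 + δ / 2 := add_le_add (hd u hu).2.2 (by rw [norm_sub_rev]; exact huv.le)
    _ = δ := add_halves δ

theorem exists_bound_of_finite {V : Type*} {T : Set V} (hT : T.Finite) (σ : List V → ℕ) (N : ℕ) :
    ∃ B, ∀ l : List V, l.length ≤ N → (∀ a ∈ l, a ∈ T) → σ l ≤ B := by
  have := hT.to_subtype
  obtain ⟨B, hB⟩ := ((List.finite_length_le T N).image fun l => σ (l.map (↑))).bddAbove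
  refine ⟨B, fun l hl hlT => ?_⟩
  lift l to List T using hlT
  exact hB ⟨l, by simpa using hl, rfl⟩

theorem exists_lt_of_mem_initialSegment {V : Type*} {x : ℕ → V} {n : ℕ} {a : V}
    (h : a ∈ initialSegment x n) : ∃ j < n, a = x j := by
  induction n with
  | zero => simp [initialSegment] at h
  | succ n ih =>
    rcases List.mem_cons.1 h with h | h
    · exact ⟨n, Nat.lt_succ_self n, h⟩
    · obtain ⟨j, hj, rfl⟩ := ih h
      exact ⟨j, hj.trans (Nat.lt_succ_self n), rfl⟩

/-- A block sequence has subsequences with arbitrarily large gaps. -/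
theorem IsBlockSeq.exists_subseq_gaps {U : ℕ → X} (hU : IsBlockSeq e U) (B : ℕ → ℕ) :
    ∃ φ : ℕ → ℕ, StrictMono φ ∧ (∀ n, ∀ k ∈ basisSupport e (U (φ n)), B 0 ≤ k) ∧
      ∀ m n, m < n → ∀ j ∈ basisSupport e (U (φ m)), ∀ k ∈ basisSupport e (U (φ n)),
        B (j + 1) ≤ k := by
  obtain ⟨φ, h0, h⟩ := exists_seq_of_forall_finset_exists
    (fun a : ℕ => ∀ k ∈ basisSupport e (U a), B 0 ≤ k)
    (fun a b => a < b ∧ ∀ j ∈ basisSupport e (U a), ∀ k ∈ basisSupport e (U b), B (j + 1) ≤ k) (by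
      intro s _
      obtain ⟨N, hN⟩ := hU.exists_support_lt (s.sup id + 1)
      refine ⟨max (B 0) (max (s.sup id + 1) ((Finset.range (N + 1)).sup B)), fun k hk =>
        (le_max_left _ _).trans (hU.index_le_of_mem hk), fun a ha =>
        ⟨?_, fun j hj k hk => ?_⟩⟩
      · have := Finset.le_sup (f := id) ha
        exact (Nat.lt_succ_of_le this).trans_le ((le_max_left _ _).trans (le_max_right _ _))
      · have hjN := hN a (Nat.lt_succ_of_le (Finset.le_sup (f := id) ha)) j hj
        exact (Finset.le_sup (f := B) (Finset.mem_range.2 (Nat.succ_lt_succ hjN))).trans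
          ((le_max_right _ _).trans ((le_max_right _ _).trans (hU.index_le_of_mem hk))))
  exact ⟨φ, fun m n hmn => (h m n hmn).1, h0, fun m n hmn => (h m n hmn).2⟩

theorem IsBlockSeq.exists_mem_of_mem_span {U : ℕ → X} (hU : IsBlockSeq e U) {v : X}
    (hv : v ∈ Submodule.span ℝ (Set.range U)) {k : ℕ} (hk : k ∈ basisSupport e v) :
    ∃ i, k ∈ basisSupport e (U i) ∧ basisSupport e (U i) ⊆ basisSupport e v := by
  obtain ⟨s, c, hc, rfl⟩ := exists_sum_of_mem_span hv
  rw [hU.basisSupport_sum hc] at hk ⊢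
  obtain ⟨i, hi, hki⟩ := Set.mem_iUnion₂.1 hk
  exact ⟨i, hki, Set.subset_biUnion_of_mem (u := fun i => basisSupport e (U i)) hi⟩

/-- If player I has a strategy in the asymptotic game to avoid being close to a sequence in the
range of `f`, then this range contains no block subsequence of some block sequence. -/
theorem exists_disjoint_of_iWins {f : (ℕ → ℕ) → ℕ → X} {ε : ℕ → ℝ} (hε : ∀ n, 0 < ε n)
    (hanti : Antitone ε) {Y : blockSeqs e (rationalVectors e)}
    (hY : (rationalBlockSystem e).IWins Y
      {x | ∀ n, ∃ i, initialSegment x i ∈ closePositions e f ε n}ᶜ []) :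
    ∃ Z, IsBlockSeq e Z ∧
      blockSubseqs e (Metric.closedBall 0 1) Z ∩ Set.range f = ∅ := by
  obtain ⟨σ, hσ⟩ := hY
  -- The place n of a block is not known from its support K, but n is at most max K, so accuracy ε
  -- (max K) suffices as ε is antitone.
  choose net hnet using fun K : Finset ℕ => exists_finset_net Y.2 K (hε (K.sup id))
  let T : ℕ → Set (rationalVectors e × Bool) := fun N =>
    {v | ∃ K ∈ (Finset.range N).powerset, v.1 ∈ net K}
  have hT : ∀ N, (T N).Finite := by
    intro N
    have : T N = ⋃ K ∈ (Finset.range N).powerset, (↑(net K) : Set _) ×ˢ Set.univ := by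
      ext v
      simp [T]
    rw [this]
    exact Set.Finite.biUnion (Finset.finite_toSet _) fun K _ =>
      (net K).finite_toSet.prod Set.finite_univ
  choose B hB using fun N => exists_bound_of_finite (hT N) σ N
  obtain ⟨φ, hφ, hgap0, hgap⟩ := Y.2.1.exists_subseq_gaps B
  have hZ : IsBlockSeq e (Y.1 ∘ φ) := Y.2.1.comp_strictMono hφ
  refine ⟨Y.1 ∘ φ, hZ, Set.eq_empty_of_forall_notMem ?_⟩
  rintro _ ⟨⟨⟨hblock, hball⟩, hspan⟩, α, rfl⟩
  have hspanY : ∀ n, f α n ∈ Submodule.span ℝ (Set.range Y.1) := fun n =>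
    mem_span_range_of_forall (fun m => Submodule.subset_span ⟨φ m, rfl⟩) (hspan n)
  have hfin : ∀ n, ∃ K : Finset ℕ, basisSupport e (f α n) = K := by
    intro n
    obtain ⟨N, hN⟩ := hblock.exists_support_lt (n + 1)
    have : (basisSupport e (f α n)).Finite :=
      (Set.finite_lt_nat N).subset fun k hk => hN n (Nat.lt_succ_self n) k hk
    exact ⟨this.toFinset, this.coe_toFinset.symm⟩
  choose K hK using hfin
  choose d hdnet hdspan hdK hdnear using fun n =>
    hnet (K n) (f α n) (hspanY n) (hK n) (by simpa using hball n)
  have hdsupp : ∀ n, basisSupport e (d n : X) = basisSupport e (f α n) := fun n =>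
    (hdK n).trans (hK n).symm
  obtain ⟨b, hbinf, rfl⟩ := exists_bitDecode_eq α
  refine hσ (fun n => (d n, b n)) rfl (fun i _ => ⟨hdspan i, fun k hk => ?_⟩)
    (exists_initialSegment_mem_closePositions hbinf fun n j _ => ⟨?_, ?_⟩)
  · rw [show ((d i, b i).1 : X) = d i from rfl, hdsupp] at hk
    rcases i with _ | i
    · obtain ⟨a, ha, -⟩ := hZ.exists_mem_of_mem_span (hspan 0) hk
      exact (hB 0 [] le_rfl (by simp)).trans (hgap0 a k ha)
    · have hne : (K i).Nonempty := by
        have := basisSupport_nonempty (e := e) (hblock.ne_zero i)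
        rwa [hK i, Finset.coe_nonempty] at this
      have hmaxmem : (K i).max' hne ∈ basisSupport e (f (bitDecode b) i) := by
        rw [hK i]
        exact (K i).max'_mem hne
      set j := (K i).max' hne with hj
      obtain ⟨a, ha, hasub⟩ := hZ.exists_mem_of_mem_span (hspan i) hmaxmem
      obtain ⟨c, hc, -⟩ := hZ.exists_mem_of_mem_span (hspan (i + 1)) hk
      have hac : a < c := by
        by_contra h
        rcases (not_lt.1 h).lt_or_eq with h | rfl
        · exact absurd (hZ.lt_of_mem h hc ha)
            (hblock.lt_of_mem (Nat.lt_succ_self i) hmaxmem hk).le.not_gt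
        · exact absurd (hblock.lt_of_mem (Nat.lt_succ_self i) (hasub hc) hk) (lt_irrefl k)
      -- With j the last support point of block i, the position has length i + 1 ≤ j + 1 and
      -- supports below j + 1, so `B (j + 1)` bounds σ there.
      refine (hB (j + 1) _ ?_ ?_).trans (hgap a c hac j ha k hc)
      · rw [length_initialSegment]
        exact Nat.succ_le_succ (hblock.index_le_of_mem hmaxmem)
      · intro v hv
        obtain ⟨m, hm, rfl⟩ := exists_lt_of_mem_initialSegment hv
        refine ⟨K m, Finset.mem_powerset.2 fun q hq => Finset.mem_range.2 ?_, hdnet m⟩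
        rcases (Nat.lt_succ_iff.1 hm).lt_or_eq with h | rfl
        · have hq' : q ∈ basisSupport e (f (bitDecode b) m) := by rw [hK m]; exact hq
          exact (hblock.lt_of_mem h hq' hmaxmem).trans (Nat.lt_succ_self j)
        · exact Nat.lt_succ_of_le ((K m).le_max' q hq)
  · exact (hblock j).congr (hdsupp j) (hdsupp (j + 1))
  · refine (hdnear j).trans (hanti ?_)
    obtain ⟨k, hk⟩ := basisSupport_nonempty (e := e) (hblock.ne_zero j)
    refine (hblock.index_le_of_mem hk).trans ?_
    rw [hK j] at hk
    exact Finset.le_sup (f := id) hk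

end AsymptoticGame

/-! ### From rational to real strategies for player II. -/

section GowersGame

variable {X : Type*} [NormedAddCommGroup X] [NormedSpace ℝ X] {e : SchauderBasis ℝ X}

/-- A block subsequence `W` of `Z` is approximated by a block subsequence of `Z` whose terms are
rational vectors, in such a way that all vectors in the span of the latter are close to vectors
with the same support in the span of `W`. -/
theorem exists_rationalBlockSeq_near {Z : blockSeqs e (rationalVectors e)} {W : ℕ → X}
    (hW : IsBlockSeq e W) (hWZ : ∀ n, W n ∈ Submodule.span ℝ (Set.range Z.1))
    {η : ℝ} (hη : 0 < η) :
    ∃ Y, (rationalBlockSystem e).le Y Z ∧ ∀ d ∈ Submodule.span ℝ (Set.range Y.1),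
      ∃ w ∈ Submodule.span ℝ (Set.range W), basisSupport e w = basisSupport e d ∧
        ‖w - d‖ ≤ η * ‖d‖ := by
  choose i hi using fun n => basisSupport_nonempty (e := e) (hW.ne_zero n)
  have hpos : ∀ n, 0 < |e.coord (i n) (W n)| := fun n => abs_pos.2 (hi n)
  -- The bound by half the coordinate keeps that of `Y n` at least half as large, so `c n` is
  -- controlled by ‖d‖; the weights 1/2/2^n sum to 1.
  let θ : ℕ → ℝ := fun n =>
    |e.coord (i n) (W n)| / 2 * min 1 (η * (1 / 2 / 2 ^ n)) / (‖e.coord (i n)‖ + 1)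
  have hθ : ∀ n, 0 < θ n := fun n => by
    have := hpos n
    positivity
  choose Y hYD hYZ hYsupp hYnear using fun n => exists_rationalVector_near Z.2.1 Z.2.2 (hWZ n) (hθ n)
  have hYblock : IsBlockSeq e Y := fun n => (hW n).congr (hYsupp n) (hYsupp (n + 1))
  have hmul : ∀ n, θ n * (‖e.coord (i n)‖ + 1) =
      |e.coord (i n) (W n)| / 2 * min 1 (η * (1 / 2 / 2 ^ n)) := fun n =>
    div_mul_cancel₀ _ (by positivity)
  have hcoord : ∀ n, |e.coord (i n) (W n)| / 2 ≤ |e.coord (i n) (Y n)| := by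
    intro n
    have h1 : |e.coord (i n) (Y n) - e.coord (i n) (W n)| ≤ |e.coord (i n) (W n)| / 2 := by
      rw [← map_sub, ← Real.norm_eq_abs]
      calc ‖e.coord (i n) (Y n - W n)‖ ≤ ‖e.coord (i n)‖ * ‖Y n - W n‖ :=
            ContinuousLinearMap.le_opNorm _ _
        _ ≤ (‖e.coord (i n)‖ + 1) * θ n := mul_le_mul (by linarith) (hYnear n) (norm_nonneg _)
            (by positivity)
        _ = |e.coord (i n) (W n)| / 2 * min 1 (η * (1 / 2 / 2 ^ n)) := by rw [mul_comm, hmul]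
        _ ≤ |e.coord (i n) (W n)| / 2 :=
            mul_le_of_le_one_right (by positivity) (min_le_left _ _)
    have h2 := abs_sub_abs_le_abs_sub (e.coord (i n) (W n)) (e.coord (i n) (Y n))
    rw [abs_sub_comm] at h2
    linarith
  refine ⟨⟨Y, hYblock, hYD⟩, hYZ, fun d hd => ?_⟩
  obtain ⟨s, c, hc, rfl⟩ := exists_sum_of_mem_span hd
  refine ⟨∑ n ∈ s, c n • W n, sum_smul_mem_span s c, ?_, ?_⟩
  · rw [hW.basisSupport_sum hc, hYblock.basisSupport_sum hc]
    simp only [hYsupp]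
  set d := ∑ n ∈ s, c n • Y n with hd_def
  have hterm : ∀ n ∈ s, ‖c n • W n - c n • Y n‖ ≤ η * ‖d‖ * (1 / 2 / 2 ^ n) := by
    intro n hn
    have hcn : |c n| * (|e.coord (i n) (W n)| / 2) ≤ (‖e.coord (i n)‖ + 1) * ‖d‖ := by
      have h1 : e.coord (i n) d = c n * e.coord (i n) (Y n) :=
        hYblock.coord_sum c hn (by rw [hYsupp]; exact hi n)
      calc |c n| * (|e.coord (i n) (W n)| / 2) ≤ |c n| * |e.coord (i n) (Y n)| :=
            mul_le_mul_of_nonneg_left (hcoord n) (abs_nonneg _)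
        _ = ‖e.coord (i n) d‖ := by rw [h1, Real.norm_eq_abs, abs_mul]
        _ ≤ ‖e.coord (i n)‖ * ‖d‖ := ContinuousLinearMap.le_opNorm _ _
        _ ≤ (‖e.coord (i n)‖ + 1) * ‖d‖ :=
            mul_le_mul_of_nonneg_right (by linarith) (norm_nonneg _)
    have hE : 0 < ‖e.coord (i n)‖ + 1 := by positivity
    rw [← smul_sub, norm_smul, Real.norm_eq_abs, norm_sub_rev]
    calc |c n| * ‖Y n - W n‖ ≤ |c n| * θ n :=
          mul_le_mul_of_nonneg_left (hYnear n) (abs_nonneg _)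
      _ = |c n| * (|e.coord (i n) (W n)| / 2) * min 1 (η * (1 / 2 / 2 ^ n)) /
            (‖e.coord (i n)‖ + 1) := by
          simp only [θ]; ring
      _ ≤ (‖e.coord (i n)‖ + 1) * ‖d‖ * (η * (1 / 2 / 2 ^ n)) / (‖e.coord (i n)‖ + 1) := by
          gcongr
          exact min_le_right _ _
      _ = η * ‖d‖ * (1 / 2 / 2 ^ n) := by field_simp
  rw [hd_def, ← Finset.sum_sub_distrib]
  calc ‖∑ n ∈ s, (c n • W n - c n • Y n)‖ ≤ ∑ n ∈ s, η * ‖d‖ * (1 / 2 / 2 ^ n) :=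
        norm_sum_le_of_le s hterm
    _ = η * ‖d‖ * ∑ n ∈ s, 1 / 2 / 2 ^ n := by rw [Finset.mul_sum]
    _ ≤ η * ‖d‖ * 1 := by
        refine mul_le_mul_of_nonneg_left ?_ (by positivity)
        exact sum_le_hasSum s (fun n _ => by positivity) (hasSum_geometric_two' 1)
    _ = η * ‖d‖ := mul_one _

theorem exists_response_near {Z : blockSeqs e (rationalVectors e)} {W : ℕ → X}
    (hW : IsBlockSeq e W) (hWZ : ∀ n, W n ∈ Submodule.span ℝ (Set.range Z.1))
    {ε : ℝ} (hε : 0 < ε) (hε1 : ε ≤ 1) :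
    ∃ Y, (rationalBlockSystem e).le Y Z ∧ ∀ d ∈ Submodule.span ℝ (Set.range Y.1),
      ∃ w ∈ Submodule.span ℝ (Set.range W), basisSupport e w = basisSupport e d ∧
        ∀ g, ‖g‖ ≤ 1 → ‖d - g‖ ≤ ε → ‖w‖ ≤ 1 ∧ ‖w - g‖ ≤ 4 * ε := by
  obtain ⟨Y, hYZ, hY⟩ := exists_rationalBlockSeq_near hW hWZ (half_pos hε)
  refine ⟨Y, hYZ, fun d hd => ?_⟩
  obtain ⟨w, hw, hwd, hnear⟩ := hY d hd
  have hpos : 0 < 1 + 2 * ε := by linarith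
  -- II does not know g when answering, so the scaling into the ball is uniform: ‖w‖ ≤ 1 + 2ε. It
  -- costs 2ε, and w to d to g costs ε twice.
  refine ⟨(1 + 2 * ε)⁻¹ • w, Submodule.smul_mem _ _ hw,
    (basisSupport_smul (inv_ne_zero hpos.ne') w).trans hwd, fun g hg hdg => ?_⟩
  have hd1 : ‖d‖ ≤ 1 + ε := by
    have := norm_le_norm_add_norm_sub' d g
    linarith
  have hnear' : ‖w - d‖ ≤ ε := hnear.trans (by nlinarith)
  have hw1 : ‖w‖ ≤ 1 + 2 * ε := by
    have := norm_le_norm_add_norm_sub' w d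
    linarith
  refine ⟨?_, ?_⟩
  · rw [norm_smul, Real.norm_of_nonneg (inv_nonneg.2 hpos.le), inv_mul_le_iff₀ hpos, mul_one]
    exact hw1
  · have h1 : ‖(1 + 2 * ε)⁻¹ • w - w‖ ≤ 2 * ε := by
      have : (1 + 2 * ε)⁻¹ • w - w = -((2 * ε) • ((1 + 2 * ε)⁻¹ • w)) := by
        rw [smul_smul, ← neg_smul]
        nth_rewrite 2 [← one_smul ℝ w]
        rw [← sub_smul]
        congr 1
        field_simp
        ring
      rw [this, norm_neg, norm_smul, Real.norm_of_nonneg (by linarith)]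
      refine mul_le_of_le_one_right (by linarith) ?_
      rw [norm_smul, Real.norm_of_nonneg (inv_nonneg.2 hpos.le), inv_mul_le_iff₀ hpos, mul_one]
      exact hw1
    calc ‖(1 + 2 * ε)⁻¹ • w - g‖ = ‖((1 + 2 * ε)⁻¹ • w - w) + (w - d) + (d - g)‖ := by
          congr 1; abel
      _ ≤ ‖(1 + 2 * ε)⁻¹ • w - w‖ + ‖w - d‖ + ‖d - g‖ := norm_add₃_le
      _ ≤ 4 * ε := by linarith

/-- The position after `n` moves when player II answers the moves `Y 0, Y 1, …` according
to `τ`. -/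
def strategyPosition {P V : Type*} (τ : List V → P → V) (Y : ℕ → P) : ℕ → List V
  | 0 => []
  | n + 1 => τ (strategyPosition τ Y n) (Y n) :: strategyPosition τ Y n

theorem strategyPosition_congr {P V : Type*} (τ : List V → P → V) {Y Y' : ℕ → P} {n : ℕ}
    (h : ∀ i < n, Y i = Y' i) : strategyPosition τ Y n = strategyPosition τ Y' n := by
  induction n with
  | zero => rfl
  | succ n ih =>
    rw [strategyPosition, strategyPosition, h n (Nat.lt_succ_self n),
      ih fun i hi => h i (hi.trans (Nat.lt_succ_self n))]

theorem initialSegment_strategyPosition {P V : Type*} (τ : List V → P → V) (Y : ℕ → P) (n : ℕ) :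
    initialSegment (fun i => τ (strategyPosition τ Y i) (Y i)) n = strategyPosition τ Y n := by
  induction n with
  | zero => rfl
  | succ n ih => rw [initialSegment, ih, strategyPosition]

/-- A winning strategy in the game with rational vectors yields one in Gowers' game. -/
theorem playerIIHasWinningStrategy_of_iiWins {f : (ℕ → ℕ) → ℕ → X} (hf : Continuous f)
    (hball : ∀ α n, ‖f α n‖ ≤ 1) {ε Δ : ℕ → ℝ} (hε : ∀ n, 0 < ε n) (hε1 : ∀ n, ε n ≤ 1)
    (hεΔ : ∀ n, 4 * ε n ≤ Δ n) {Z : blockSeqs e (rationalVectors e)}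
    (hZ : (rationalBlockSystem e).IIWins Z
      {x | ∀ n, ∃ i, initialSegment x i ∈ closePositions e f ε n} []) :
    PlayerIIHasWinningStrategy e (Metric.closedBall 0 1) Z.1
      (blockExpansion e (Set.range f) Δ) := by
  obtain ⟨τ, hτ, hwin⟩ := hZ
  have hR : ∀ (n : ℕ) (W : ℕ → X), ∃ (Y : blockSeqs e (rationalVectors e)) (r : X → X),
      W ∈ blockSubseqs e (Metric.closedBall 0 1) Z.1 → (rationalBlockSystem e).le Y Z ∧
        ∀ d ∈ Submodule.span ℝ (Set.range Y.1), r d ∈ Submodule.span ℝ (Set.range W) ∧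
          basisSupport e (r d) = basisSupport e d ∧
          ∀ g, ‖g‖ ≤ 1 → ‖d - g‖ ≤ ε n → ‖r d‖ ≤ 1 ∧ ‖r d - g‖ ≤ 4 * ε n := by
    intro n W
    by_cases hW : W ∈ blockSubseqs e (Metric.closedBall 0 1) Z.1
    · obtain ⟨Y, hYZ, hY⟩ := exists_response_near hW.1.1 hW.2 (hε n) (hε1 n)
      choose! r hr using hY
      exact ⟨Y, r, fun _ => ⟨hYZ, hr⟩⟩
    · exact ⟨Z, id, fun h => absurd h hW⟩
  choose A r hAr using hR
  -- The `min` only makes the index legal; the position after n moves depends on indices below n.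
  refine ⟨fun n h => r n (h (Fin.last n)) (τ (strategyPosition τ
    (fun i => A i (h ⟨min i n, Nat.lt_succ_of_le (min_le_right i n)⟩)) n)
      (A n (h (Fin.last n)))).1, fun W hW => ?_⟩
  let Y : ℕ → blockSeqs e (rationalVectors e) := fun n => A n (W n)
  let x : ℕ → rationalVectors e × Bool := fun n => τ (strategyPosition τ Y n) (Y n)
  have hYZ : ∀ n, (rationalBlockSystem e).le (Y n) Z := fun n => (hAr n (W n) (hW n)).1
  have hplay : PlayerIIStrategy.play (fun n h => r n (h (Fin.last n)) (τ (strategyPosition τ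
      (fun i => A i (h ⟨min i n, Nat.lt_succ_of_le (min_le_right i n)⟩)) n)
        (A n (h (Fin.last n)))).1) W = fun n => r n (W n) (x n).1 := by
    funext n
    have : strategyPosition τ (fun i => A i (W (min i n))) n = strategyPosition τ Y n :=
      strategyPosition_congr τ fun i hi => by rw [min_eq_left hi.le]
    simp only [PlayerIIStrategy.play, Fin.val_last, this, x, Y]
  rw [hplay]
  obtain ⟨hblock, α, hα⟩ := close_of_forall_exists_mem_closePositions hf
    (hwin x ⟨rfl, fun i _ => ⟨Y i, hYZ i, by rw [initialSegment_strategyPosition]⟩⟩)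
  have hr := fun n => (hAr n (W n) (hW n)).2 (x n).1 (hτ _ _ (hYZ n)).1
  have hrb : IsBlockSeq e fun n => r n (W n) (x n).1 := fun n =>
    (hblock n).congr (hr n).2.1 (hr (n + 1)).2.1
  have hnear := fun n => (hr n).2.2 (f α n) (hball α n) (hα n)
  exact ⟨fun n => ⟨by simpa using (hnear n).1, (hr n).1⟩, hrb, hrb, f α, ⟨α, rfl⟩,
    fun n => (hnear n).2.trans (hεΔ n)⟩

end GowersGame

/-! ### Choice of tolerances and conclusion. -/

theorem exists_antitone_le {Δ : ℕ → ℝ} (hΔ : ∀ n, 0 < Δ n) :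
    ∃ ε : ℕ → ℝ, (∀ n, 0 < ε n) ∧ Antitone ε ∧ (∀ n, ε n ≤ 1) ∧ ∀ n, 4 * ε n ≤ Δ n := by
  let ε : ℕ → ℝ := fun n => Nat.rec (min 1 (Δ 0 / 4)) (fun n a => min a (Δ (n + 1) / 4)) n
  have hanti : Antitone ε := antitone_nat_of_succ_le fun n => min_le_left _ _
  refine ⟨ε, fun n => ?_, hanti, fun n => (hanti (Nat.zero_le n)).trans (min_le_left _ _),
    fun n => ?_⟩
  · induction n with
    | zero => exact lt_min one_pos (div_pos (hΔ 0) four_pos)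
    | succ n ih => exact lt_min ih (div_pos (hΔ _) four_pos)
  · have : ε n ≤ Δ n / 4 := by
      rcases n with _ | n
      · exact min_le_right _ _
      · exact min_le_right _ _
    linarith

theorem mainTheorem2 {X : Type*} [NormedAddCommGroup X] [NormedSpace ℝ X]
    (e : SchauderBasis ℝ X) (F : Set (ℕ → X))
    (hF : F ⊆ blockSeqs e (Metric.closedBall 0 1))
    (hFan : MeasureTheory.AnalyticSet F)
    (Δ : ℕ → ℝ) (hΔ : ∀ n, 0 < Δ n) :
    ∃ Z : ℕ → X, IsBlockSeq e Z ∧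
      (blockSubseqs e (Metric.closedBall 0 1) Z ∩ F = ∅ ∨
        PlayerIIHasWinningStrategy e (Metric.closedBall 0 1) Z (blockExpansion e F Δ)) := by
  rw [MeasureTheory.AnalyticSet] at hFan
  rcases hFan with rfl | ⟨f, hf, rfl⟩
  · exact ⟨e, isBlockSeq_basis e, Or.inl (Set.inter_empty _)⟩
  obtain ⟨ε, hε, hanti, hε1, hεΔ⟩ := exists_antitone_le hΔ
  have := (countable_rationalVectors e).to_subtype
  obtain ⟨Z, -, hI | hII⟩ := FusionSystem.exists_iWins_or_iiWins (S := rationalBlockSystem e)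
    (closePositions e f ε) (cons_mem_closePositions f ε)
    ⟨e, isBlockSeq_basis e, basis_mem_rationalVectors⟩
  · obtain ⟨Z', hZ', h⟩ := exists_disjoint_of_iWins hε hanti hI
    exact ⟨Z', hZ', Or.inl h⟩
  · refine ⟨Z.1, Z.2.1, Or.inr (playerIIHasWinningStrategy_of_iiWins hf (fun α n => ?_) hε hε1
      hεΔ hII)⟩
    simpa using (hF ⟨α, rfl⟩).2 n
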